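/- Let $T$ be a nonempty string over an arbitrary alphabet $\Sigma$ (for instance a string terminated by a letter occurring nowhere else in it). The empty string $\varepsilon$ counts as occurring at all $|T|+1$ positions of $T$. A right-extension (left-extension) of a substring $w$ is a substring of $T$ of the form $wa$ ($aw$) with $a\in\Sigma$. A maximal repeat of $T$ is a substring $w$ with at least two occurrences in $T$ all of whose left- and right-extensions occur strictly fewer times in $T$ than $w$. Let $\mu_T$, $e_T^r$ and $e_T^\ell$ be the numbers of maximal repeats of $T$, of right-extensions of maximal repeats, and of left-extensions of maximal repeats, and let $\tilde e_T=e_T^r+e_T^\ell$. For substrings $x,y$ of $T$ write $x\equiv_L y$ (resp. $x\equiv_R y$) if $x$ and $y$ have the same set of beginning (resp. ending) positions in $T$. Let $\overrightarrow{x}$ be the longest string that is $\equiv_L$-equivalent to $x$ and let $[x]_R$ be the $\equiv_R$-class of $x$. The graph $\mathrm{CDAWG}(T)=(V_0,E_0)$ has nodes $V_0=\{[\overrightarrow{x}]_R : x \text{ a substring of } T\}$ and source $[\varepsilon]_R$. For every substring $x$ with $x=\overrightarrow{x}$ and every letter $a$ such that $xa$ is a substring of $T$, it has the labelled edge $([x]_R,\,a\beta,\,[xa\beta]_R)$,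 where $xa\beta=\overrightarrow{xa}$; equal triples are one edge. The graph $\text{L-CDAWG}(T)=(V,E)$ is obtained from $\mathrm{CDAWG}(T)$ as follows. For every node in $V_0$, with longest member $u$, and every letter $a$ such that $au$ is a substring of $T$, if the path from the source spelling $au$ ends strictly inside an edge, then a new node (a type-2 node) is inserted at that point, splitting the edge. If several such paths end at the same point, only one node is inserted there. After all insertions, each resulting edge with label $x\in\Sigma^+$ is stored with the first letter of $x$ and the length $|x|$. Then $V$ and $E$ are finite, and $$|V| = O(\mu_T+e_T^\ell),\qquad |E| = O(\tilde e_T),$$ where the constants in the $O$-notation are absolute, that is, independent of $T$ and of $\Sigma$. -/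

import Mathlib

namespace CDAWG

universe u

variable {A : Type u}

/-! ### Occurrences, maximal repeats and their extensions

Strings over the alphabet `A` are lists; `x <:+: T` says that `x` is a substring of `T`.
Positions are counted from `0`, and the empty string occurs at all `T.length + 1` of them. -/

/-- The beginning positions of `x` in `T`. -/
def begPos (T x : List A) : Set ℕ := {i | ∃ y z, T = y ++ x ++ z ∧ y.length = i}

/-- The ending positions of `x` in `T`. -/
def endPos (T x : List A) : Set ℕ := {j | ∃ y z, T = y ++ x ++ z ∧ (y ++ x).length = j}

theorem begPos_finite (T x : List A) : (begPos T x).Finite := by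
  refine (Set.finite_Iic T.length).subset ?_
  rintro i ⟨y, z, h, rfl⟩
  simp [h, Set.mem_Iic]

/-- The number of occurrences of `x` in `T`. -/
noncomputable def occ (T x : List A) : ℕ := (begPos T x).ncard

/-- `v` is a right-extension of `w` in `T`. -/
def IsRightExt (T w v : List A) : Prop := v <:+: T ∧ ∃ a : A, v = w ++ [a]

/-- `v` is a left-extension of `w` in `T`. -/
def IsLeftExt (T w v : List A) : Prop := v <:+: T ∧ ∃ a : A, v = a :: w

def IsRepeat (T w : List A) : Prop := w <:+: T ∧ 1 < occ T w

/-- A repeat all of whose left- and right-extensions occur strictly fewer times. -/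
def IsMaximalRepeat (T w : List A) : Prop :=
  IsRepeat T w ∧ (∀ v, IsLeftExt T w v → occ T v < occ T w) ∧
    ∀ v, IsRightExt T w v → occ T v < occ T w

/-- `μ_T`, the number of maximal repeats. -/
noncomputable def numMaxRepeats (T : List A) : ℕ := {w | IsMaximalRepeat T w}.ncard

/-- `e_T^r`, the number of right-extensions of maximal repeats. -/
noncomputable def numRightExts (T : List A) : ℕ :=
  {v | ∃ w, IsMaximalRepeat T w ∧ IsRightExt T w v}.ncard

/-- `e_T^ℓ`, the number of left-extensions of maximal repeats. -/
noncomputable def numLeftExts (T : List A) : ℕ :=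
  {v | ∃ w, IsMaximalRepeat T w ∧ IsLeftExt T w v}.ncard

/-- `ẽ_T`, the number of all extensions of maximal repeats. -/
noncomputable def numExts (T : List A) : ℕ := numRightExts T + numLeftExts T

/-! ### Edge-labelled directed graphs -/

/-- A directed graph with nodes in `N` and edges `(hi, label, lo)` labelled in `L`. -/
structure LabeledGraph (N : Type*) (L : Type*) where
  nodes : Set N
  edges : Set (N × L × N)

/-- `Path G p w q`: some path of `G` from `p` to `q` spells out `w`. -/
inductive Path {N : Type*} (G : LabeledGraph N (List A)) : N → List A → N → Prop
  | nil (p : N) (hp : p ∈ G.nodes) : Path G p [] p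
  | cons {p q r : N} {x w : List A} (he : (p, x, q) ∈ G.edges) (h : Path G q w r) :
      Path G p (x ++ w) r

/-- The path spelling out `w` from node `s` ends strictly inside the edge `e`,
after the first `k` letters of its label. -/
def EndsInside {N : Type*} (G : LabeledGraph N (List A)) (s : N) (w : List A)
    (e : N × List A × N) (k : ℕ) : Prop :=
  e ∈ G.edges ∧ 0 < k ∧ k < e.2.1.length ∧ ∃ w', Path G s w' e.1 ∧ w = w' ++ e.2.1.take k

/-! ### The compact directed acyclic word graph -/

/-- The class of `x` in the relation `≡_L` (equal beginning positions) on substrings of `T`. -/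
def classL (T x : List A) : Set (List A) := {y | y <:+: T ∧ begPos T y = begPos T x}

/-- The class of `x` in the relation `≡_R` (equal ending positions) on substrings of `T`. -/
def classR (T x : List A) : Set (List A) := {y | y <:+: T ∧ endPos T y = endPos T x}

/-- `y` is the longest member of the set `S` of strings. -/
def IsLongest (S : Set (List A)) (y : List A) : Prop := y ∈ S ∧ ∀ z ∈ S, z.length ≤ y.length

/-- `y` is the longest string that is `≡_L`-equivalent to `x`. -/
def IsLrep (T x y : List A) : Prop := IsLongest (classL T x) y

/-- `y` is the longest string that is `≡_R`-equivalent to `x`. -/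
def IsRrep (T x y : List A) : Prop := IsLongest (classR T x) y

/-- `z` is the `≡_R`-representative of the `≡_L`-representative of `x`. -/
def IsBrep (T x z : List A) : Prop := ∃ y, IsLrep T x y ∧ IsRrep T y z

/-- The equivalence `x ≡ y` of having the same two-sided representative. -/
def Equiv (T x y : List A) : Prop := ∃ z, IsBrep T x z ∧ IsBrep T y z

/-- `CDAWG(T)`. A node is the `≡_R`-class of the `≡_L`-representative `y` of a substring `x`.
For each letter `a` such that `y a` is a substring there is one edge leaving it; its label `a β`
is the one for which `y a β` is the `≡_L`-representative of `y a`, so that labels leaving a node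
start with distinct letters. -/
def cdawg (T : List A) : LabeledGraph (Set (List A)) (List A) where
  nodes := {c | ∃ x y, x <:+: T ∧ IsLrep T x y ∧ c = classR T y}
  edges := {e | ∃ (x y : List A) (a : A) (β : List A), x <:+: T ∧ IsLrep T x y ∧
    y ++ [a] <:+: T ∧ IsLrep T (y ++ [a]) (y ++ a :: β) ∧ ¬ Equiv T y (y ++ a :: β) ∧
    e = (classR T y, a :: β, classR T (y ++ a :: β))}

/-- The source of `CDAWG(T)`, the class of the empty string. -/
def source (T : List A) : Set (List A) := classR T []

/-! ### The linear-size CDAWG -/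

abbrev CdawgEdge (A : Type u) : Type u := Set (List A) × List A × Set (List A)

/-- Nodes of the linear-size CDAWG: nodes of the CDAWG (type 1) and interior points of its
edges, given by the edge and the number of letters of its label before the point (type 2). -/
inductive LNode (A : Type u) : Type u
  | type1 (c : Set (List A))
  | type2 (e : CdawgEdge A) (k : ℕ)

/-- There is a type-2 node after the first `k` letters of the edge `e`: it represents `a u`,
where `u` is the value (longest member) of a node of the CDAWG and `a u` is a substring of `T`
whose path from the source ends there, strictly inside the edge. -/
def IsType2 (T : List A) (e : CdawgEdge A) (k : ℕ) : Prop :=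
  ∃ c ∈ (cdawg T).nodes, ∃ (u : List A) (a : A), IsLongest c u ∧ a :: u <:+: T ∧
    EndsInside (cdawg T) (source T) (a :: u) e k

/-- `v` is the node that sits on the edge `e` after the first `k` letters of its label:
an end point of `e` or a type-2 node. -/
inductive OnEdge (T : List A) (e : CdawgEdge A) : ℕ → LNode A → Prop
  | hi : OnEdge T e 0 (.type1 e.1)
  | lo : OnEdge T e e.2.1.length (.type1 e.2.2)
  | mid {k : ℕ} (h : IsType2 T e k) : OnEdge T e k (.type2 e k)

/-- The CDAWG after all type-2 nodes are inserted: each edge is cut into the pieces between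
consecutive nodes on it, and each piece keeps its part of the label. -/
def splitCdawg (T : List A) : LabeledGraph (LNode A) (List A) where
  nodes := {v | (∃ c ∈ (cdawg T).nodes, v = .type1 c) ∨ ∃ e k, IsType2 T e k ∧ v = .type2 e k}
  edges := {f | ∃ e ∈ (cdawg T).edges, ∃ (i j : ℕ) (p q : LNode A), i < j ∧
    OnEdge T e i p ∧ OnEdge T e j q ∧ (∀ m v, i < m → m < j → ¬ OnEdge T e m v) ∧
    f = (p, (e.2.1.take j).drop i, q)}

/-- `L-CDAWG(T)`: the label `x` of each edge is replaced by its first letter, stored together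
with the length of `x`. -/
def lcdawg (T : List A) : LabeledGraph (LNode A) (A × ℕ) where
  nodes := (splitCdawg T).nodes
  edges := {f | ∃ (p q : LNode A) (c : A) (x : List A), (p, c :: x, q) ∈ (splitCdawg T).edges ∧
    f = (p, (c, (c :: x).length), q)}

end CDAWG

namespace CDAWG

universe v

variable {A : Type v}

/-! ### Counting through an injective relation -/

/-! Every node and edge is charged injectively to a maximal repeat or to an extension of one. The
longest member `u` of a CDAWG node is left-maximal as the longest in its `≡_R`-class, and
right-maximal because the class contains a longest `≡_L`-member. So `u` is a maximal repeat, unless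
it occurs only once, and then it is `T` (`isMaximalRepeat_or_eq`). This gives at most `μ_T + 1`
nodes. An edge is determined by its origin and first letter `a` (`cdawg_edge_unique`), so it is
charged to the right-extension `u a`. A type-2 node is charged to a left-extension `a u` leading to
it; since the graph is deterministic, `a u` leads to only one point (`path_inside_unique`). After
splitting, a piece is determined by its starting point, which is the start of an old edge or a
type-2 node. Hence `|V| ≤ μ_T + 1 + e_T^ℓ` and `|E| ≤ e_T^r + e_T^ℓ`. -/

theorem finite_and_ncard_le_of_rel {α β : Type*} {S : Set α} {T : Set β} (hT : T.Finite)
    (R : α → β → Prop) (h : ∀ s ∈ S, ∃ t ∈ T, R s t)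
    (inj : ∀ s s' t, R s t → R s' t → s = s') : S.Finite ∧ S.ncard ≤ T.ncard := by
  classical
  by_cases hS : S.Nonempty
  · obtain ⟨s₀, hs₀⟩ := hS
    obtain ⟨t₀, -, -⟩ := h s₀ hs₀
    -- `t₀` is the default value outside `S`; with `S` empty, `β` might have no element to serve.
    have h' : ∀ s, ∃ t, s ∈ S → t ∈ T ∧ R s t := by
      intro s
      by_cases hs : s ∈ S
      · obtain ⟨t, ht⟩ := h s hs
        exact ⟨t, fun _ => ht⟩
      · exact ⟨t₀, fun hs' => absurd hs' hs⟩
    choose f hf using h'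
    have hmaps : Set.MapsTo f S T := fun s hs => (hf s hs).1
    have hinj : Set.InjOn f S := fun s hs s' hs' e =>
      inj s s' (f s) (hf s hs).2 (e ▸ (hf s' hs').2)
    exact ⟨Set.Finite.of_injOn hmaps hinj hT,
      Set.ncard_le_ncard_of_injOn f hmaps hinj hT⟩
  · rw [Set.not_nonempty_iff_eq_empty] at hS
    subst hS
    simp

/-! ### Beginning and ending positions -/

theorem infix_finite (T : List A) : {x : List A | x <:+: T}.Finite := by
  refine (T.sublists.finite_toSet).subset ?_
  intro x hx
  exact List.mem_sublists.2 (List.IsInfix.sublist hx)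

theorem endPos_eq_image (T x : List A) : endPos T x = (· + x.length) '' begPos T x := by
  ext j
  constructor
  · rintro ⟨y, z, h, rfl⟩
    exact ⟨y.length, ⟨y, z, h, rfl⟩, by simp⟩
  · rintro ⟨i, ⟨y, z, h, rfl⟩, rfl⟩
    exact ⟨y, z, h, by simp⟩

theorem endPos_finite (T x : List A) : (endPos T x).Finite := by
  rw [endPos_eq_image]
  exact (begPos_finite T x).image _

theorem ncard_endPos (T x : List A) : (endPos T x).ncard = occ T x := by
  rw [endPos_eq_image, Set.ncard_image_of_injective _ (add_left_injective _)]
  rfl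

theorem begPos_nonempty_iff {T x : List A} : (begPos T x).Nonempty ↔ x <:+: T := by
  constructor
  · rintro ⟨_, y, z, h, -⟩
    exact ⟨y, z, h.symm⟩
  · rintro ⟨y, z, h⟩
    exact ⟨_, y, z, h.symm, rfl⟩

theorem endPos_nonempty_iff {T x : List A} : (endPos T x).Nonempty ↔ x <:+: T := by
  rw [endPos_eq_image, Set.image_nonempty, begPos_nonempty_iff]

theorem occ_pos {T x : List A} (h : x <:+: T) : 0 < occ T x :=
  (Set.ncard_pos (begPos_finite T x)).2 (begPos_nonempty_iff.2 h)

theorem begPos_append_subset (T x w : List A) : begPos T (x ++ w) ⊆ begPos T x := by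
  rintro _ ⟨y, z, h, rfl⟩
  exact ⟨y, w ++ z, by simp [h], rfl⟩

theorem endPos_append_subset (T w x : List A) : endPos T (w ++ x) ⊆ endPos T x := by
  rintro _ ⟨y, z, h, rfl⟩
  exact ⟨y ++ w, z, by simp [h], by simp⟩

/-- Two occurrences meeting at a position can be joined. -/
theorem exists_append_of_mem {T x w : List A} {j : ℕ} (h₁ : j ∈ endPos T x)
    (h₂ : j ∈ begPos T w) : ∃ y z, T = y ++ x ++ w ++ z ∧ (y ++ x).length = j := by
  obtain ⟨y, z, h, hj⟩ := h₁
  obtain ⟨y', z', h', hj'⟩ := h₂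
  have := h.symm.trans (h'.trans (List.append_assoc _ _ _))
  obtain ⟨-, e⟩ := List.append_inj this (hj.trans hj'.symm)
  exact ⟨y, z', by rw [h, e]; simp, hj⟩

theorem mem_endPos_append {T x w : List A} {j : ℕ} :
    j ∈ endPos T (x ++ w) ↔ ∃ i ∈ endPos T x, i ∈ begPos T w ∧ j = i + w.length := by
  constructor
  · rintro ⟨y, z, h, rfl⟩
    exact ⟨(y ++ x).length, ⟨y, w ++ z, by simp [h], rfl⟩, ⟨y ++ x, z, by simp [h], rfl⟩,
      by simp [add_assoc]⟩
  · rintro ⟨i, h₁, h₂, rfl⟩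
    obtain ⟨y, z, h, rfl⟩ := exists_append_of_mem h₁ h₂
    exact ⟨y, z, by simp [h], by simp [add_assoc]⟩

theorem endPos_append_congr {T x y : List A} (h : endPos T x = endPos T y) (w : List A) :
    endPos T (x ++ w) = endPos T (y ++ w) := by
  ext j
  simp only [mem_endPos_append, h]

/-- The right side says that every occurrence of `x` is followed by `w`. It sees `x` only through
its ending positions, so right completion is compatible with `≡_R`. -/
theorem begPos_append_eq_iff {T x w : List A} :
    begPos T (x ++ w) = begPos T x ↔ endPos T x ⊆ begPos T w := by
  constructor
  · rintro h _ ⟨y, z, e, rfl⟩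
    have hy : y.length ∈ begPos T (x ++ w) := h ▸ ⟨y, z, e, rfl⟩
    obtain ⟨y', z', e', hl⟩ := hy
    exact ⟨y' ++ x, z', by simp [e'], by simp [hl]⟩
  · refine fun h => (begPos_append_subset T x w).antisymm ?_
    rintro _ ⟨y, z, e, rfl⟩
    have h₁ : (y ++ x).length ∈ endPos T x := ⟨y, z, e, rfl⟩
    obtain ⟨y', z', e', hl⟩ := exists_append_of_mem h₁ (h h₁)
    exact ⟨y', z', by simp [e'], by simpa using hl⟩

theorem eq_of_mem_begPos {T w w' : List A} {j : ℕ} (h : j ∈ begPos T w) (h' : j ∈ begPos T w')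
    (hl : w.length = w'.length) : w = w' := by
  obtain ⟨y, z, e, hj⟩ := h
  obtain ⟨y', z', e', hj'⟩ := h'
  rw [List.append_assoc] at e e'
  obtain ⟨-, h₂⟩ := List.append_inj (e.symm.trans e') (hj.trans hj'.symm)
  exact (List.append_inj h₂ hl).1

/-! ### Representatives and maximality -/

theorem occ_rightExt_lt {T x y : List A} (h : IsLrep T x y) {v : List A}
    (hv : IsRightExt T y v) : occ T v < occ T y := by
  obtain ⟨hv, a, rfl⟩ := hv
  refine Set.ncard_lt_ncard ((begPos_append_subset T y [a]).ssubset_of_ne fun e => ?_)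
    (begPos_finite T y)
  have := h.2 (y ++ [a]) ⟨hv, e.trans h.1.2⟩
  simp at this

theorem occ_leftExt_lt {T y u : List A} (h : IsRrep T y u) {v : List A}
    (hv : IsLeftExt T u v) : occ T v < occ T u := by
  obtain ⟨hv, a, rfl⟩ := hv
  rw [← ncard_endPos, ← ncard_endPos]
  refine Set.ncard_lt_ncard ((endPos_append_subset T [a] u).ssubset_of_ne fun e => ?_)
    (endPos_finite T u)
  have := h.2 (a :: u) ⟨hv, e.trans h.1.2⟩
  simp at this

theorem classR_congr {T x y : List A} (h : endPos T x = endPos T y) :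
    classR T x = classR T y := by
  simp only [classR, h]

theorem exists_isRrep {T y : List A} (h : y <:+: T) : ∃ u, IsRrep T y u := by
  have hfin : (classR T y).Finite := (infix_finite T).subset fun _ hx => hx.1
  obtain ⟨u, hu, hmax⟩ := Set.exists_max_image _ List.length hfin ⟨y, h, rfl⟩
  exact ⟨u, hu, hmax⟩

/-- The value of a node is a maximal repeat or the whole text. -/
theorem isMaximalRepeat_or_eq {T x y u : List A} (hy : IsLrep T x y) (hu : IsRrep T y u) :
    IsMaximalRepeat T u ∨ u = T := by
  have hocc : occ T u = occ T y := by
    rw [← ncard_endPos, ← ncard_endPos, hu.1.2]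
  have hright : ∀ v, IsRightExt T u v → occ T v < occ T u := by
    rintro _ ⟨hv, a, rfl⟩
    have e := endPos_append_congr hu.1.2 [a]
    rw [hocc, ← ncard_endPos, e, ncard_endPos]
    refine occ_rightExt_lt hy ⟨?_, a, rfl⟩
    rwa [← endPos_nonempty_iff, ← e, endPos_nonempty_iff]
  have hleft : ∀ v, IsLeftExt T u v → occ T v < occ T u := fun v hv => occ_leftExt_lt hu hv
  by_cases h1 : 1 < occ T u
  · exact .inl ⟨⟨hu.1.1, h1⟩, hleft, hright⟩
  -- Now `u` occurs exactly once. A letter beside that occurrence would give an extension occurring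
  -- at least once, against maximality.
  right
  obtain ⟨p, s, h⟩ := hu.1.1
  have hs : s = [] := by
    rcases s with _ | ⟨b, s⟩
    · rfl
    have hi : u ++ [b] <:+: T := ⟨p, s, by simp [← h]⟩
    have := hright _ ⟨hi, b, rfl⟩
    have := occ_pos hi
    omega
  have hp : p = [] := by
    rcases p.eq_nil_or_concat with rfl | ⟨p, b, rfl⟩
    · rfl
    have hi : b :: u <:+: T := ⟨p, s, by simp [← h]⟩
    have := hleft _ ⟨hi, b, rfl⟩
    have := occ_pos hi
    omega
  simpa [hs, hp] using h

theorem occ_nil (T : List A) : occ T [] = T.length + 1 := by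
  have : begPos T [] = Set.Iio (T.length + 1) := by
    ext i
    simp only [Set.mem_Iio, Nat.lt_succ_iff]
    constructor
    · rintro ⟨y, z, h, rfl⟩
      simp [h]
    · intro h
      exact ⟨T.take i, T.drop i, by simp, by simpa using h⟩
  rw [occ, this, ← Finset.coe_Iio, Set.ncard_coe_finset, Nat.card_Iio]

theorem occ_singleton_le (T : List A) (a : A) : occ T [a] ≤ T.length := by
  have : begPos T [a] ⊆ Set.Iio T.length := by
    rintro _ ⟨y, z, h, rfl⟩
    simp [h]
  calc occ T [a] ≤ (Set.Iio T.length).ncard := Set.ncard_le_ncard this (Set.finite_Iio _)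
    _ = T.length := by rw [← Finset.coe_Iio, Set.ncard_coe_finset, Nat.card_Iio]

/-- This makes `μ_T` positive, so that the extra node for `T` is absorbed by the constant. -/
theorem isMaximalRepeat_nil {T : List A} (hT : T ≠ []) : IsMaximalRepeat T [] := by
  have h0 := List.length_pos_iff.2 hT
  refine ⟨⟨List.nil_infix, by rw [occ_nil]; omega⟩, ?_, ?_⟩ <;>
  · rintro _ ⟨-, a, rfl⟩
    rw [occ_nil]
    exact Nat.lt_succ_of_le (occ_singleton_le T a)

theorem maxRepeats_finite (T : List A) : {w | IsMaximalRepeat T w}.Finite :=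
  (infix_finite T).subset fun _ h => h.1.1

theorem rightExts_finite (T : List A) :
    {v | ∃ w, IsMaximalRepeat T w ∧ IsRightExt T w v}.Finite :=
  (infix_finite T).subset fun _ ⟨_, _, h⟩ => h.1

theorem leftExts_finite (T : List A) :
    {v | ∃ w, IsMaximalRepeat T w ∧ IsLeftExt T w v}.Finite :=
  (infix_finite T).subset fun _ ⟨_, _, h⟩ => h.1

theorem not_append_infix_self (T : List A) (a : A) : ¬ T ++ [a] <:+: T := fun h => by
  have := h.length_le
  simp at this

theorem not_cons_infix_self (T : List A) (a : A) : ¬ a :: T <:+: T := fun h => by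
  have := h.length_le
  simp at this

/-! ### Nodes and edges of the CDAWG -/

theorem exists_value_of_mem_nodes {T : List A} {c : Set (List A)} (hc : c ∈ (cdawg T).nodes) :
    ∃ u, c = classR T u ∧ (IsMaximalRepeat T u ∨ u = T) := by
  obtain ⟨x, y, -, hy, rfl⟩ := hc
  obtain ⟨u, hu⟩ := exists_isRrep hy.1.1
  exact ⟨u, (classR_congr hu.1.2).symm, isMaximalRepeat_or_eq hy hu⟩

theorem isMaximalRepeat_or_eq_of_isLongest {T : List A} {c : Set (List A)}
    (hc : c ∈ (cdawg T).nodes) {u : List A} (hu : IsLongest c u) :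
    IsMaximalRepeat T u ∨ u = T := by
  obtain ⟨x, y, -, hy, rfl⟩ := hc
  exact isMaximalRepeat_or_eq hy hu

theorem cdawg_nodes_finite_and_ncard_le (T : List A) :
    (cdawg T).nodes.Finite ∧ (cdawg T).nodes.ncard ≤ numMaxRepeats T + 1 := by
  obtain ⟨h₁, h₂⟩ := finite_and_ncard_le_of_rel ((maxRepeats_finite T).insert T)
    (fun c u => c = classR T u) (S := (cdawg T).nodes)
    (fun c hc => by
      obtain ⟨u, h, h'⟩ := exists_value_of_mem_nodes hc
      exact ⟨u, h'.symm, h⟩)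
    (fun _ _ _ h h' => h.trans h'.symm)
  exact ⟨h₁, h₂.trans (Set.ncard_insert_le _ _)⟩

theorem length_le_of_isLrep_append {T y y' β β' : List A} (h : endPos T y = endPos T y')
    (hβ : IsLrep T y (y ++ β)) (hβ' : IsLrep T y' (y' ++ β')) : β'.length ≤ β.length := by
  have h₁ : begPos T (y ++ β') = begPos T y := by
    rw [begPos_append_eq_iff, h, ← begPos_append_eq_iff]
    exact hβ'.1.2
  have h₂ : y ++ β' <:+: T := by
    rw [← begPos_nonempty_iff, h₁, ← hβ.1.2, begPos_nonempty_iff]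
    exact hβ.1.1
  simpa using hβ.2 _ ⟨h₂, h₁⟩

/-- The right completion of a string depends only on its ending positions. -/
theorem isLrep_append_unique {T y y' β β' : List A} (h : endPos T y = endPos T y')
    (hβ : IsLrep T y (y ++ β)) (hβ' : IsLrep T y' (y' ++ β')) : β = β' := by
  have hl := (length_le_of_isLrep_append h.symm hβ' hβ).antisymm
    (length_le_of_isLrep_append h hβ hβ')
  have hne : y <:+: T := by
    rw [← begPos_nonempty_iff, ← hβ.1.2, begPos_nonempty_iff]
    exact hβ.1.1
  obtain ⟨j, hj⟩ := endPos_nonempty_iff.2 hne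
  exact eq_of_mem_begPos (begPos_append_eq_iff.1 hβ.1.2 hj)
    (begPos_append_eq_iff.1 hβ'.1.2 (h ▸ hj)) hl

/-- Edges leaving a node are determined by the first letter of their label. -/
theorem cdawg_edge_unique {T : List A} {e e' : CdawgEdge A} (he : e ∈ (cdawg T).edges)
    (he' : e' ∈ (cdawg T).edges) (h₁ : e.1 = e'.1) (h₂ : e.2.1.head? = e'.2.1.head?) :
    e = e' := by
  obtain ⟨x, y, a, β, -, hy, -, hβ, -, rfl⟩ := he
  obtain ⟨x', y', a', β', -, hy', -, hβ', -, rfl⟩ := he'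
  obtain rfl : a = a' := by simpa using h₂
  have h : endPos T y = endPos T y' := by
    have : y ∈ classR T y' := by
      rw [← show classR T y = classR T y' from h₁]
      exact ⟨hy.1.1, rfl⟩
    exact this.2
  obtain rfl : β = β' := by
    refine isLrep_append_unique (endPos_append_congr h [a]) ?_ ?_ <;> simpa
  rw [classR_congr h, classR_congr (endPos_append_congr h (a :: β))]

theorem cdawg_label_ne_nil {T : List A} {e : CdawgEdge A} (he : e ∈ (cdawg T).edges) :
    e.2.1 ≠ [] := by
  obtain ⟨x, y, a, β, -, -, -, -, -, rfl⟩ := he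
  simp

theorem cdawg_edges_finite_and_ncard_le (T : List A) :
    (cdawg T).edges.Finite ∧ (cdawg T).edges.ncard ≤ numRightExts T := by
  refine finite_and_ncard_le_of_rel (rightExts_finite T)
    (fun e v => e ∈ (cdawg T).edges ∧ ∃ u a, v = u ++ [a] ∧ e.1 = classR T u ∧
      e.2.1.head? = some a) ?_ ?_
  · intro e he
    have he₀ := he
    obtain ⟨x, y, a, β, -, hy, hya, -, -, rfl⟩ := he
    obtain ⟨u, hu⟩ := exists_isRrep hy.1.1
    have hua : u ++ [a] <:+: T := by
      rwa [← endPos_nonempty_iff, endPos_append_congr hu.1.2, endPos_nonempty_iff]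
    -- The exceptional value `T` has no right-extension, so no edge leaves its node.
    have hmax : IsMaximalRepeat T u := (isMaximalRepeat_or_eq hy hu).resolve_right fun h =>
      not_append_infix_self T a (by rwa [h] at hua)
    exact ⟨u ++ [a], ⟨u, hmax, hua, a, rfl⟩, he₀, u, a, rfl, (classR_congr hu.1.2).symm, rfl⟩
  · rintro e e' _ ⟨he, u, a, rfl, h₁, h₂⟩ ⟨he', u', a', hv, h₁', h₂'⟩
    obtain ⟨rfl, h⟩ := List.append_inj' hv rfl
    obtain rfl : a = a' := by simpa using h
    exact cdawg_edge_unique he he' (h₁.trans h₁'.symm) (h₂.trans h₂'.symm)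

/-! ### Points inside edges -/

/-- In a deterministic graph, a string leads to at most one point inside an edge. -/
theorem path_inside_unique {N : Type*} {G : LabeledGraph N (List A)}
    (hne : ∀ e ∈ G.edges, e.2.1 ≠ [])
    (hdet : ∀ e ∈ G.edges, ∀ e' ∈ G.edges, e.1 = e'.1 → e.2.1.head? = e'.2.1.head? → e = e')
    {s r r' : N} {w w' : List A} (hp : Path G s w r) (hp' : Path G s w' r')
    {e e' : N × List A × N} {k k' : ℕ} (hr : r = e.1) (hr' : r' = e'.1)
    (he : e ∈ G.edges) (he' : e' ∈ G.edges) (hk : 0 < k) (hk' : 0 < k')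
    (hkl : k < e.2.1.length) (hkl' : k' < e'.2.1.length)
    (h : w ++ e.2.1.take k = w' ++ e'.2.1.take k') : e = e' ∧ k = k' := by
  have head_append : ∀ x z : List A, x ≠ [] → (x ++ z).head? = x.head? := by
    intro x z hx
    cases x with
    | nil => exact absurd rfl hx
    | cons a x => rfl
  have head_take : ∀ (x : List A) (n : ℕ), 0 < n → (x.take n).head? = x.head? := by
    intro x n hn
    simp [List.head?_take, hn.ne']
  -- Equal first letters force both strings into the same edge. If one stops inside it and the other
  -- traverses it whole, the lengths disagree.
  induction hp generalizing w' with
  | nil p hp =>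
    cases hp' with
    | nil =>
      have hh := congrArg List.head? h
      simp only [List.nil_append, head_take _ _ hk, head_take _ _ hk'] at hh
      obtain rfl := hdet e he e' he' (hr.symm.trans hr') hh
      have hl := congrArg List.length h
      simp only [List.nil_append, List.length_take] at hl
      exact ⟨rfl, by omega⟩
    | @cons _ q _ x v hx hv =>
      have hh := congrArg List.head? h
      rw [List.nil_append, List.append_assoc, head_take _ _ hk, head_append _ _ (hne _ hx)] at hh
      obtain rfl := hdet e he _ hx hr.symm hh
      have hl := congrArg List.length h
      simp only [List.nil_append, List.length_take, List.length_append] at hl hkl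
      omega
  | @cons p q r x v hx hv ih =>
    cases hp' with
    | nil =>
      have hh := congrArg List.head? h
      rw [List.nil_append, List.append_assoc, head_take _ _ hk', head_append _ _ (hne _ hx)] at hh
      obtain rfl := hdet e' he' _ hx hr'.symm hh.symm
      have hl := congrArg List.length h
      simp only [List.nil_append, List.length_take, List.length_append] at hl hkl'
      omega
    | @cons _ q' _ x' v' hx' hv' =>
      have hh := congrArg List.head? h
      rw [List.append_assoc, List.append_assoc, head_append _ _ (hne _ hx),
        head_append _ _ (hne _ hx')] at hh
      have hxx := hdet _ hx _ hx' rfl hh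
      simp only [Prod.mk.injEq, true_and] at hxx
      obtain ⟨rfl, rfl⟩ := hxx
      refine ih hv' hr ?_
      simpa using h

theorem endsInside_unique {T : List A} {s : Set (List A)} {w : List A} {e e' : CdawgEdge A}
    {k k' : ℕ} (h : EndsInside (cdawg T) s w e k) (h' : EndsInside (cdawg T) s w e' k') :
    e = e' ∧ k = k' := by
  obtain ⟨he, hk, hkl, w₁, hp, rfl⟩ := h
  obtain ⟨he', hk', hkl', w₂, hp', hw⟩ := h'
  exact path_inside_unique (fun e he => cdawg_label_ne_nil he)
    (fun e he e' he' => cdawg_edge_unique he he') hp hp' rfl rfl he he' hk hk' hkl hkl' hw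

theorem type2_finite_and_ncard_le (T : List A) :
    {f : CdawgEdge A × ℕ | IsType2 T f.1 f.2}.Finite ∧
      {f : CdawgEdge A × ℕ | IsType2 T f.1 f.2}.ncard ≤ numLeftExts T := by
  refine finite_and_ncard_le_of_rel (leftExts_finite T)
    (fun f v => EndsInside (cdawg T) (source T) v f.1 f.2) ?_ ?_
  · rintro f ⟨c, hc, u, a, hu, hau, hin⟩
    have hmax := (isMaximalRepeat_or_eq_of_isLongest hc hu).resolve_right fun h =>
      not_cons_infix_self T a (by rwa [h] at hau)
    exact ⟨a :: u, ⟨u, hmax, hau, a, rfl⟩, hin⟩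
  · rintro f f' v h h'
    exact Prod.ext_iff.2 (endsInside_unique h h')

theorem IsType2.pos_and_lt {T : List A} {e : CdawgEdge A} {k : ℕ} (h : IsType2 T e k) :
    0 < k ∧ k < e.2.1.length := by
  obtain ⟨c, -, u, a, -, -, -, h₁, h₂, -⟩ := h
  exact ⟨h₁, h₂⟩

theorem OnEdge.le {T : List A} {e : CdawgEdge A} {k : ℕ} {p : LNode A} (h : OnEdge T e k p) :
    k ≤ e.2.1.length := by
  cases h with
  | hi => exact Nat.zero_le _
  | lo => exact le_rfl
  | mid h => exact h.pos_and_lt.2.le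

theorem OnEdge.unique {T : List A} {e : CdawgEdge A} (he : e.2.1 ≠ []) {k : ℕ} {p q : LNode A}
    (hp : OnEdge T e k p) (hq : OnEdge T e k q) : p = q := by
  have hlen := List.length_pos_iff.2 he
  have key : ∀ k p, OnEdge T e k p → (k = 0 ∧ p = .type1 e.1) ∨
      (k = e.2.1.length ∧ p = .type1 e.2.2) ∨
      (0 < k ∧ k < e.2.1.length ∧ p = .type2 e k) := by
    intro k p h
    cases h with
    | hi => exact .inl ⟨rfl, rfl⟩
    | lo => exact .inr (.inl ⟨rfl, rfl⟩)
    | mid h => exact .inr (.inr ⟨h.pos_and_lt.1, h.pos_and_lt.2, rfl⟩)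
  rcases key k p hp with ⟨h, rfl⟩ | ⟨h, rfl⟩ | ⟨h, h', rfl⟩ <;>
  rcases key k q hq with ⟨g, rfl⟩ | ⟨g, rfl⟩ | ⟨g, g', rfl⟩ <;>
  first
  | rfl
  | (exfalso; omega)

/-! ### Size of the linear-size CDAWG -/

theorem lcdawg_nodes_finite_and_ncard_le (T : List A) :
    (lcdawg T).nodes.Finite ∧
      (lcdawg T).nodes.ncard ≤ numMaxRepeats T + 1 + numLeftExts T := by
  obtain ⟨h₁, h₁'⟩ := cdawg_nodes_finite_and_ncard_le T
  obtain ⟨h₂, h₂'⟩ := type2_finite_and_ncard_le T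
  have heq : (lcdawg T).nodes = LNode.type1 '' (cdawg T).nodes ∪
      (fun f : CdawgEdge A × ℕ => LNode.type2 f.1 f.2) '' {f | IsType2 T f.1 f.2} := by
    ext p
    constructor
    · rintro (⟨c, hc, rfl⟩ | ⟨e, k, h, rfl⟩)
      · exact .inl ⟨c, hc, rfl⟩
      · exact .inr ⟨(e, k), h, rfl⟩
    · rintro (⟨c, hc, rfl⟩ | ⟨f, h, rfl⟩)
      · exact .inl ⟨c, hc, rfl⟩
      · exact .inr ⟨f.1, f.2, h, rfl⟩
  rw [heq]
  exact ⟨(h₁.image _).union (h₂.image _), (Set.ncard_union_le _ _).trans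
    (add_le_add ((Set.ncard_image_le h₁).trans h₁') ((Set.ncard_image_le h₂).trans h₂'))⟩

theorem lcdawg_edges_finite_and_ncard_le (T : List A) :
    (lcdawg T).edges.Finite ∧ (lcdawg T).edges.ncard ≤ numExts T := by
  obtain ⟨h₁, h₁'⟩ := cdawg_edges_finite_and_ncard_le T
  obtain ⟨h₂, h₂'⟩ := type2_finite_and_ncard_le T
  refine (finite_and_ncard_le_of_rel (S := (lcdawg T).edges)
    -- Starting points of pieces: offset `0` on an old edge, or a type-2 node.
    ((h₁.image fun e => (e, 0)).union h₂)
    (fun f t => t.1 ∈ (cdawg T).edges ∧ ∃ (j : ℕ) (p q : LNode A) (c : A) (x : List A),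
      t.2 < j ∧ OnEdge T t.1 t.2 p ∧ OnEdge T t.1 j q ∧
      (∀ m v, t.2 < m → m < j → ¬ OnEdge T t.1 m v) ∧
      c :: x = (t.1.2.1.take j).drop t.2 ∧ f = (p, (c, (c :: x).length), q)) ?_ ?_).imp_right
    fun h => h.trans ((Set.ncard_union_le _ _).trans
      (add_le_add ((Set.ncard_image_le h₁).trans h₁') h₂'))
  · rintro f ⟨p, q, c, x, ⟨e, he, i, j, p', q', hij, hp, hq, hm, heq⟩, rfl⟩
    simp only [Prod.mk.injEq] at heq
    obtain ⟨rfl, hx, rfl⟩ := heq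
    refine ⟨(e, i), ?_, he, j, p, q, c, x, hij, hp, hq, hm, hx, rfl⟩
    cases hp with
    | hi => exact .inl ⟨e, he, rfl⟩
    | lo => exact absurd hq.le (not_le.2 hij)
    | mid h => exact .inr h
  · rintro f f' ⟨e, i⟩ ⟨he, j, p, q, c, x, hij, hp, hq, hm, hx, rfl⟩
      ⟨-, j', p', q', c', x', hij', hp', hq', hm', hx', rfl⟩
    have hne := cdawg_label_ne_nil he
    obtain rfl : p = p' := hp.unique hne hp'
    -- Both pieces end at the first node after offset `i`.
    obtain rfl : j = j' := by
      rcases lt_trichotomy j j' with h | h | h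
      · exact absurd hq (hm' j q hij h)
      · exact h
      · exact absurd hq' (hm j' q' hij' h)
    obtain rfl : q = q' := hq.unique hne hq'
    obtain ⟨rfl, rfl⟩ := List.cons.inj (hx.trans hx'.symm)
    rfl

theorem numMaxRepeats_pos {T : List A} (hT : T ≠ []) : 0 < numMaxRepeats T :=
  (Set.ncard_pos (maxRepeats_finite T)).2 ⟨[], isMaximalRepeat_nil hT⟩

end CDAWG

theorem mainTheorem2 :
    ∃ C : ℕ, ∀ (A : Type*) (T : List A), T ≠ [] →
      ((CDAWG.lcdawg T).nodes.Finite ∧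
        (CDAWG.lcdawg T).nodes.ncard ≤ C * (CDAWG.numMaxRepeats T + CDAWG.numLeftExts T)) ∧
      ((CDAWG.lcdawg T).edges.Finite ∧
        (CDAWG.lcdawg T).edges.ncard ≤ C * CDAWG.numExts T) := by
  -- The factor `2` is needed only for the nodes: `μ_T + 1 ≤ 2 μ_T`.
  refine ⟨2, fun A T hT => ?_⟩
  obtain ⟨h₁, h₁'⟩ := CDAWG.lcdawg_nodes_finite_and_ncard_le T
  obtain ⟨h₂, h₂'⟩ := CDAWG.lcdawg_edges_finite_and_ncard_le T
  have := CDAWG.numMaxRepeats_pos hT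
  exact ⟨⟨h₁, by omega⟩, h₂, by omega⟩
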